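/- Let $n\ge 1$ and $1\le p\le\infty$, and let $f\in L^p_{loc}(\mathbb R^n)$ be a real-valued function. Then there exists a solution $u$ of $$\Delta u=f\quad\text{on all of } \mathbb R^n$$ in the sense of distributions, i.e. a function $u\in L^1_{loc}(\mathbb R^n)$ such that $$\int_{\mathbb R^n}u\,\Delta\varphi\,dx=\int_{\mathbb R^n}f\,\varphi\,dx\qquad\text{for all }\varphi\in C_c^\infty(\mathbb R^n).$$ -/

import Mathlib

open MeasureTheory
open scoped ENNReal ContDiff Laplacian

/-- `f ∈ L^p_loc(ℝⁿ)`: the restriction of `f` to every compact set is an `L^p` function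
with respect to Lebesgue measure. -/
def MemLpLoc {n : ℕ} (f : EuclideanSpace ℝ (Fin n) → ℝ) (p : ℝ≥0∞) : Prop :=
  ∀ K : Set (EuclideanSpace ℝ (Fin n)), IsCompact K → MemLp f p (volume.restrict K)

/-- `u` is a solution of `Δ u = f` on all of `ℝⁿ` (in the weak, i.e. distributional, sense):
`u` and `f` are locally integrable functions and `∫ u Δφ = ∫ f φ` for every smooth compactly
supported test function `φ`. Here `Δ φ` is the classical Laplacian of `φ`. -/
def IsWeakSolutionPoisson {n : ℕ} (u f : EuclideanSpace ℝ (Fin n) → ℝ) : Prop :=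
  LocallyIntegrable u volume ∧ LocallyIntegrable f volume ∧
    ∀ φ : EuclideanSpace ℝ (Fin n) → ℝ, ContDiff ℝ ∞ φ → HasCompactSupport φ →
      ∫ x, u x * (Δ φ) x = ∫ x, f x * φ x

/-! Convolving `f` with the fundamental solution E would solve the equation, but that integral may
diverge, since `f` may grow arbitrarily. The cure is a Mittag-Leffler correction. For ‖x‖ small
compared with ‖y‖, E(x - y) is the sum of its homogeneous Taylor polynomials in x. Subtracting
finitely many of them, all harmonic on ℝⁿ, leaves a kernel G with Δₓ G(·, y) = c δ_y that is as
small as desired. The number of terms on the shell ⌊‖y‖⌋ = k is chosen so that |G| ≤ 2⁻ᵏ / (1 +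
∫_shell |f|) once 8(‖x‖ + 1) ≤ ‖y‖ (`exists_degrees`). Then u(x) = c⁻¹ ∫ G(x, y) f(y) dy is locally
integrable (`integrable_correctedKernel_mul`), and Fubini gives the equation. Only local
integrability of `f` matters.

The fundamental solution property (`integral_radialKernel_mul_laplacian`) comes from replacing ‖·‖²
by ‖·‖² + δ², whose Laplacian is an approximate identity. It is proved for E(l x - y) with any l ≠
0, because the Taylor polynomials are the coefficients of this function in powers of l. Holomorphy
in l yields Cauchy estimates (`abs_kernelCoeff_le`) with no explicit formula. Harmonicity
(`integral_kernelCoeff_mul_laplacian`) follows too: for small l ≠ 0, pairing with Δφ gives a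
multiple of φ(y / l) = 0, so a power series in l vanishes and so do its coefficients. -/

/-- A primitive of `s ↦ s ^ (-n / 2)` on the positive half-line, so that
`x ↦ radialKernel n (‖x‖ ^ 2)` is proportional to the fundamental solution of the Laplacian. -/
noncomputable def radialKernel (n : ℕ) (s : ℝ) : ℝ :=
  if n = 2 then Real.log s else s ^ (1 - n / 2 : ℝ) / (1 - n / 2)

theorem one_sub_half_ne_zero {n : ℕ} (h : n ≠ 2) : (1 - n / 2 : ℝ) ≠ 0 := by
  intro h0
  have : (n : ℝ) = 2 := by linarith
  exact h (by exact_mod_cast this)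

theorem hasDerivAt_radialKernel (n : ℕ) {s : ℝ} (hs : 0 < s) :
    HasDerivAt (radialKernel n) (s ^ (-(n / 2) : ℝ)) s := by
  unfold radialKernel
  split_ifs with h
  · subst h
    convert! Real.hasDerivAt_log hs.ne' using 1
    norm_num [Real.rpow_neg_one]
  · have h1 := one_sub_half_ne_zero h
    convert! (Real.hasDerivAt_rpow_const (p := (1 - n / 2 : ℝ)) (Or.inl hs.ne')).div_const
      (1 - n / 2 : ℝ) using 1
    rw [mul_div_assoc, mul_comm, div_mul_cancel₀ _ h1]
    congr 1
    ring

theorem contDiffAt_radialKernel (n : ℕ) {s : ℝ} (hs : 0 < s) :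
    ContDiffAt ℝ ∞ (radialKernel n) s := by
  unfold radialKernel
  split_ifs with h
  · exact Real.contDiffAt_log.2 hs.ne'
  · exact (Real.contDiffAt_rpow_const_of_ne hs.ne').div_const _

theorem monotoneOn_radialKernel (n : ℕ) : MonotoneOn (radialKernel n) (Set.Ioi 0) := by
  refine monotoneOn_of_deriv_nonneg (convex_Ioi 0)
    (fun s hs => (hasDerivAt_radialKernel n hs).continuousAt.continuousWithinAt) ?_ ?_
  · rw [interior_Ioi]
    exact fun s hs => (hasDerivAt_radialKernel n hs).differentiableAt.differentiableWithinAt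
  · rw [interior_Ioi]
    intro s hs
    rw [(hasDerivAt_radialKernel n hs).deriv]
    exact Real.rpow_nonneg (le_of_lt hs) _

theorem measurable_radialKernel (n : ℕ) : Measurable (radialKernel n) := by
  unfold radialKernel
  split_ifs
  · exact Real.measurable_log
  · fun_prop

/-! ### Second derivatives and Green's identity -/

theorem fderiv_fderiv_apply_eq {E : Type*} [NormedAddCommGroup E] [NormedSpace ℝ E] {g : E → ℝ}
    (hg : ContDiff ℝ 2 g) (x v : E) :
    iteratedFDeriv ℝ 2 g x ![v, v] = fderiv ℝ (fun z => fderiv ℝ g z v) x v := by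
  have h : DifferentiableAt ℝ (fderiv ℝ g) x :=
    (hg.fderiv_right (m := 1) (by norm_num)).differentiable (by norm_num) x
  rw [iteratedFDeriv_two_apply, fderiv_clm_apply h (by fun_prop)]
  simp

/-- The second derivatives can be moved to the other factor when one factor is compactly
supported. -/
theorem integral_mul_iteratedFDeriv_two {n : ℕ} {g φ : EuclideanSpace ℝ (Fin n) → ℝ}
    (hg : ContDiff ℝ 2 g) (hφ : ContDiff ℝ 2 φ) (hc : HasCompactSupport φ)
    (v : EuclideanSpace ℝ (Fin n)) :
    ∫ x, g x * iteratedFDeriv ℝ 2 φ x ![v, v] = ∫ x, iteratedFDeriv ℝ 2 g x ![v, v] * φ x := by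
  have hg1 : ContDiff ℝ 1 (fun z => fderiv ℝ g z v) :=
    (hg.fderiv_right (m := 1) (by norm_num)).clm_apply contDiff_const
  have hφ1 : ContDiff ℝ 1 (fun z => fderiv ℝ φ z v) :=
    (hφ.fderiv_right (m := 1) (by norm_num)).clm_apply contDiff_const
  have hg2 : Continuous (fun z => fderiv ℝ (fun z => fderiv ℝ g z v) z v) :=
    (hg1.continuous_fderiv (by norm_num)).clm_apply continuous_const
  have hφ2 : Continuous (fun z => fderiv ℝ (fun z => fderiv ℝ φ z v) z v) :=
    (hφ1.continuous_fderiv (by norm_num)).clm_apply continuous_const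
  have hc1 : HasCompactSupport (fun z => fderiv ℝ φ z v) := hc.fderiv_apply ℝ v
  have hc2 : HasCompactSupport (fun z => fderiv ℝ (fun z => fderiv ℝ φ z v) z v) :=
    hc1.fderiv_apply ℝ v
  simp_rw [fderiv_fderiv_apply_eq hg, fderiv_fderiv_apply_eq hφ]
  have hd : ∀ {f : EuclideanSpace ℝ (Fin n) → ℝ} {m : WithTop ℕ∞}, ContDiff ℝ m f → m ≠ 0 →
    Differentiable ℝ f := fun h hm => h.differentiable hm
  rw [integral_mul_fderiv_eq_neg_fderiv_mul_of_integrable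
      ((hg1.continuous.mul hφ1.continuous).integrable_of_hasCompactSupport hc1.mul_left)
      ((hg.continuous.mul hφ2).integrable_of_hasCompactSupport hc2.mul_left)
      ((hg.continuous.mul hφ1.continuous).integrable_of_hasCompactSupport hc1.mul_left)
      (fun x _ => hd hg (by norm_num) x) (fun x _ => hd hφ1 (by norm_num) x),
    integral_mul_fderiv_eq_neg_fderiv_mul_of_integrable
      ((hg2.mul hφ.continuous).integrable_of_hasCompactSupport hc.mul_left)
      ((hg1.continuous.mul hφ1.continuous).integrable_of_hasCompactSupport hc1.mul_left)
      ((hg1.continuous.mul hφ.continuous).integrable_of_hasCompactSupport hc.mul_left)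
      (fun x _ => hd hg1 (by norm_num) x) (fun x _ => hd hφ (by norm_num) x), neg_neg]

theorem continuous_iteratedFDeriv_two_apply {n : ℕ} {g : EuclideanSpace ℝ (Fin n) → ℝ}
    (hg : ContDiff ℝ 2 g) (v : EuclideanSpace ℝ (Fin n)) :
    Continuous fun x => iteratedFDeriv ℝ 2 g x ![v, v] :=
  (ContinuousMultilinearMap.apply ℝ _ ℝ ![v, v]).continuous.comp
    (hg.continuous_iteratedFDeriv (by norm_num))

theorem hasCompactSupport_iteratedFDeriv_two_apply {n : ℕ} {φ : EuclideanSpace ℝ (Fin n) → ℝ}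
    (hc : HasCompactSupport φ) (v : EuclideanSpace ℝ (Fin n)) :
    HasCompactSupport fun x => iteratedFDeriv ℝ 2 φ x ![v, v] :=
  (hc.iteratedFDeriv (𝕜 := ℝ) 2).comp_left
    (g := fun p : ContinuousMultilinearMap ℝ (fun _ : Fin 2 => EuclideanSpace ℝ (Fin n)) ℝ =>
      p ![v, v]) rfl

theorem laplacian_eq_sum {n : ℕ} (g : EuclideanSpace ℝ (Fin n) → ℝ) :
    Δ g = fun x => ∑ i, iteratedFDeriv ℝ 2 g x
      ![EuclideanSpace.basisFun (Fin n) ℝ i, EuclideanSpace.basisFun (Fin n) ℝ i] :=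
  InnerProductSpace.laplacian_eq_iteratedFDeriv_orthonormalBasis g
    (EuclideanSpace.basisFun (Fin n) ℝ)

theorem continuous_laplacian {n : ℕ} {g : EuclideanSpace ℝ (Fin n) → ℝ} (hg : ContDiff ℝ 2 g) :
    Continuous (Δ g) := by
  rw [laplacian_eq_sum]
  exact continuous_finsetSum _ fun i _ => continuous_iteratedFDeriv_two_apply hg _

theorem hasCompactSupport_laplacian {n : ℕ} {φ : EuclideanSpace ℝ (Fin n) → ℝ}
    (hc : HasCompactSupport φ) : HasCompactSupport (Δ φ) := by
  refine HasCompactSupport.intro hc (fun x hx => ?_)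
  rw [laplacian_eq_sum]
  refine Finset.sum_eq_zero fun i _ => ?_
  have : x ∉ tsupport (iteratedFDeriv ℝ 2 φ) := fun h => hx (tsupport_iteratedFDeriv_subset 2 h)
  rw [image_eq_zero_of_notMem_tsupport this]
  rfl

/-- Green's second identity for a compactly supported test function. -/
theorem integral_mul_laplacian {n : ℕ} {g φ : EuclideanSpace ℝ (Fin n) → ℝ}
    (hg : ContDiff ℝ 2 g) (hφ : ContDiff ℝ 2 φ) (hc : HasCompactSupport φ) :
    ∫ x, g x * (Δ φ) x = ∫ x, (Δ g) x * φ x := by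
  rw [laplacian_eq_sum, laplacian_eq_sum]
  simp_rw [Finset.mul_sum, Finset.sum_mul]
  rw [integral_finsetSum, integral_finsetSum]
  · exact Finset.sum_congr rfl fun i _ => integral_mul_iteratedFDeriv_two hg hφ hc _
  · exact fun i _ => ((continuous_iteratedFDeriv_two_apply hg _).mul
      hφ.continuous).integrable_of_hasCompactSupport hc.mul_left
  · exact fun i _ => (hg.continuous.mul
      (continuous_iteratedFDeriv_two_apply hφ _)).integrable_of_hasCompactSupport
      (hasCompactSupport_iteratedFDeriv_two_apply hc _).mul_left

/-! ### The regularized kernel and its Laplacian -/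

section Regularized

variable {n : ℕ} (l ε : ℝ) (y : EuclideanSpace ℝ (Fin n))

theorem contDiff_radialKernel_regularized (hε : 0 < ε) :
    ContDiff ℝ ∞ fun x : EuclideanSpace ℝ (Fin n) => radialKernel n (‖l • x - y‖ ^ 2 + ε) := by
  rw [contDiff_iff_contDiffAt]
  intro x
  refine (contDiffAt_radialKernel n (by positivity)).comp x ?_
  have h : ContDiff ℝ ∞ fun x : EuclideanSpace ℝ (Fin n) => l • x - y := by fun_prop
  exact ((h.norm_sq ℝ).add contDiff_const).contDiffAt

theorem hasFDerivAt_normSq_regularized (x : EuclideanSpace ℝ (Fin n)) :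
    HasFDerivAt (fun x => ‖l • x - y‖ ^ 2 + ε)
      ((2 * l) • innerSL ℝ (l • x - y)) x := by
  have h := ((((hasFDerivAt_id x).const_smul l).sub_const y).norm_sq).add_const ε
  convert! h using 1
  ext v
  simp
  ring

theorem fderiv_radialKernel_regularized (hε : 0 < ε) (x v : EuclideanSpace ℝ (Fin n)) :
    fderiv ℝ (fun x => radialKernel n (‖l • x - y‖ ^ 2 + ε)) x v =
      (‖l • x - y‖ ^ 2 + ε) ^ (-(n / 2) : ℝ) * (2 * l * inner ℝ (l • x - y) v) := by
  have h := (hasDerivAt_radialKernel n (s := ‖l • x - y‖ ^ 2 + ε) (by positivity)).comp_hasFDerivAt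
    x (hasFDerivAt_normSq_regularized l ε y x)
  have h' := h.fderiv
  rw [Function.comp_def] at h'
  simp only [h', smul_apply, innerSL_apply_apply, smul_eq_mul]

theorem iteratedFDeriv_radialKernel_regularized (hε : 0 < ε) (x v : EuclideanSpace ℝ (Fin n)) :
    iteratedFDeriv ℝ 2 (fun x => radialKernel n (‖l • x - y‖ ^ 2 + ε)) x ![v, v] =
      -(2 * n * l ^ 2) * (‖l • x - y‖ ^ 2 + ε) ^ (-(n / 2) - 1 : ℝ) * (inner ℝ (l • x - y) v) ^ 2
        + 2 * l ^ 2 * (‖l • x - y‖ ^ 2 + ε) ^ (-(n / 2) : ℝ) * ‖v‖ ^ 2 := by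
  rw [fderiv_fderiv_apply_eq ((contDiff_radialKernel_regularized l ε y hε).of_le (by norm_cast)),
    funext fun z => fderiv_radialKernel_regularized l ε y hε z v]
  have hq : 0 < ‖l • x - y‖ ^ 2 + ε := by positivity
  have h1 := (Real.hasDerivAt_rpow_const (p := (-(n / 2) : ℝ))
    (Or.inl hq.ne')).comp_hasFDerivAt x (hasFDerivAt_normSq_regularized l ε y x)
  have h2 : HasFDerivAt (fun z => 2 * l * inner ℝ (l • z - y) v)
      ((2 * l * l) • innerSL ℝ v) x := by
    have := ((((hasFDerivAt_id x).const_smul l).sub_const y).inner ℝ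
      (hasFDerivAt_const v x)).const_mul (2 * l)
    convert! this using 1
    ext w
    simp [inner_smul_left, real_inner_comm]
    ring
  have h3 : HasFDerivAt (fun z => (‖l • z - y‖ ^ 2 + ε) ^ (-(n / 2) : ℝ) *
    (2 * l * inner ℝ (l • z - y) v)) _ x := h1.mul h2
  rw [h3.fderiv]
  simp only [Function.comp_apply, add_apply, smul_apply,
    innerSL_apply_apply, smul_eq_mul, real_inner_self_eq_norm_sq]
  ring

theorem laplacian_radialKernel_regularized (hε : 0 < ε) (x : EuclideanSpace ℝ (Fin n)) :
    (Δ fun x => radialKernel n (‖l • x - y‖ ^ 2 + ε)) x =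
      l ^ 2 * (2 * n * ε * (‖l • x - y‖ ^ 2 + ε) ^ (-(n / 2) - 1 : ℝ)) := by
  rw [laplacian_eq_sum]
  have hq : 0 < ‖l • x - y‖ ^ 2 + ε := by positivity
  simp_rw [iteratedFDeriv_radialKernel_regularized l ε y hε]
  rw [Finset.sum_add_distrib, ← Finset.mul_sum, OrthonormalBasis.sum_sq_inner_left]
  simp
  -- Over a common power, the ‖l • x - y‖² terms cancel and only the multiple of ε survives.
  have : (‖l • x - y‖ ^ 2 + ε) ^ (-(n / 2) : ℝ) =
      (‖l • x - y‖ ^ 2 + ε) * (‖l • x - y‖ ^ 2 + ε) ^ (-(n / 2) - 1 : ℝ) := by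
    rw [Real.rpow_sub_one hq.ne']
    field_simp
  rw [this]
  ring

theorem integral_radialKernel_regularized (hε : 0 < ε) {φ : EuclideanSpace ℝ (Fin n) → ℝ}
    (hφ : ContDiff ℝ ∞ φ) (hc : HasCompactSupport φ) :
    ∫ x, radialKernel n (‖l • x - y‖ ^ 2 + ε) * (Δ φ) x =
      l ^ 2 * ∫ x, 2 * n * ε * (‖l • x - y‖ ^ 2 + ε) ^ (-(n / 2) - 1 : ℝ) * φ x := by
  rw [integral_mul_laplacian ((contDiff_radialKernel_regularized l ε y hε).of_le (by norm_cast))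
    (hφ.of_le (by norm_cast)) hc, ← integral_const_mul]
  refine integral_congr_ae (Filter.Eventually.of_forall fun x => ?_)
  simp only [laplacian_radialKernel_regularized l ε y hε x]
  ring

end Regularized

section

open Filter Topology Set

/-! ### The fundamental solution, by removing the regularization -/

/-- The total mass of `Δ (radialKernel n (‖x‖ ^ 2))`. -/
noncomputable def radialKernelMass (n : ℕ) : ℝ :=
  ∫ z : EuclideanSpace ℝ (Fin n), 2 * n * (1 + ‖z‖ ^ 2) ^ (-(n + 2 : ℝ) / 2)

theorem integrable_radialKernelMass (n : ℕ) :
    Integrable fun z : EuclideanSpace ℝ (Fin n) =>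
      2 * n * (1 + ‖z‖ ^ 2) ^ (-(n + 2 : ℝ) / 2) :=
  (integrable_rpow_neg_one_add_norm_sq (by simp)).const_mul _

theorem radialKernelMass_pos {n : ℕ} (hn : 1 ≤ n) : 0 < radialKernelMass n := by
  have hn' : (0 : ℝ) < n := by exact_mod_cast hn
  have hp : ∀ z : EuclideanSpace ℝ (Fin n), 0 < 2 * n * (1 + ‖z‖ ^ 2) ^ (-(n + 2 : ℝ) / 2) :=
    fun z => by positivity
  rw [radialKernelMass, integral_pos_iff_support_of_nonneg (fun z => (hp z).le)
    (integrable_radialKernelMass n)]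
  rw [show Function.support (fun z : EuclideanSpace ℝ (Fin n) =>
    2 * n * (1 + ‖z‖ ^ 2) ^ (-(n + 2 : ℝ) / 2)) = univ from
    eq_univ_of_forall fun z => (hp z).ne']
  exact Measure.measure_univ_pos.2 (NeZero.ne _)

/-- Where the radial profile is singular at the origin, the Jacobian compensates. -/
theorem exists_continuous_pow_mul_radialKernel {n : ℕ} (hn : 1 ≤ n) :
    ∃ g : ℝ → ℝ, Continuous g ∧
      ∀ r, 0 < r → r ^ (n - 1) * radialKernel n (r ^ 2) = g r := by
  by_cases h : n = 2
  · subst h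
    refine ⟨fun r => 2 * (r * Real.log r), by fun_prop, fun r hr => ?_⟩
    simp [radialKernel]
    ring
  · refine ⟨fun r => r / (1 - n / 2), by fun_prop, fun r hr => ?_⟩
    simp only [radialKernel, if_neg h]
    rw [← mul_div_assoc]
    congr 1
    rw [← Real.rpow_natCast, ← Real.rpow_natCast r 2, ← Real.rpow_mul hr.le, ← Real.rpow_add hr]
    push_cast [hn]
    ring_nf
    exact Real.rpow_one r

theorem integrableOn_radialKernel_norm_sq {n : ℕ} (hn : 1 ≤ n) (R : ℝ) :
    IntegrableOn (fun z : EuclideanSpace ℝ (Fin n) => radialKernel n (‖z‖ ^ 2))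
      (Metric.ball 0 R) := by
  have : Nonempty (Fin n) := ⟨⟨0, hn⟩⟩
  have : Nontrivial (EuclideanSpace ℝ (Fin n)) := inferInstance
  rw [integrableOn_fun_norm_addHaar volume (f := fun r => radialKernel n (r ^ 2))]
  obtain ⟨g, hg, hgr⟩ := exists_continuous_pow_mul_radialKernel hn
  have : IntegrableOn g (Ioo 0 R) :=
    (hg.continuousOn.integrableOn_compact isCompact_Icc).mono_set Ioo_subset_Icc_self
  refine this.congr_fun (fun r hr => ?_) measurableSet_Ioo
  simp [← hgr r hr.1]

theorem integrableOn_radialKernel_affine {n : ℕ} (hn : 1 ≤ n) {l : ℝ} (hl : l ≠ 0)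
    (y : EuclideanSpace ℝ (Fin n)) (L : ℝ) :
    IntegrableOn (fun x => radialKernel n (‖l • x - y‖ ^ 2)) (Metric.closedBall 0 L) := by
  set R := |l| * L + ‖y‖ + 1 with hR
  have h := (integrable_indicator_iff Metric.isOpen_ball.measurableSet).2
    (integrableOn_radialKernel_norm_sq hn R)
  have h2 := (h.comp_sub_right y).comp_smul hl
  refine h2.integrableOn.congr_fun (fun x hx => ?_) Metric.isClosed_closedBall.measurableSet
  have hx' : l • x - y ∈ Metric.ball (0 : EuclideanSpace ℝ (Fin n)) R := by
    rw [mem_ball_zero_iff]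
    rw [mem_closedBall_zero_iff] at hx
    have := norm_sub_le (l • x) y
    rw [norm_smul, Real.norm_eq_abs] at this
    have := mul_le_mul_of_nonneg_left hx (abs_nonneg l)
    linarith
  simp [indicator_of_mem hx']

theorem integrable_radialKernel_mul {n : ℕ} (hn : 1 ≤ n) {l : ℝ} (hl : l ≠ 0)
    (y : EuclideanSpace ℝ (Fin n)) {ψ : EuclideanSpace ℝ (Fin n) → ℝ}
    (hψ : Continuous ψ) (hc : HasCompactSupport ψ) :
    Integrable fun x => radialKernel n (‖l • x - y‖ ^ 2) * ψ x := by
  suffices h : LocallyIntegrable (fun x => radialKernel n (‖l • x - y‖ ^ 2)) volume from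
    h.integrable_smul_right_of_hasCompactSupport hψ hc
  rw [locallyIntegrable_iff]
  intro K hK
  obtain ⟨L, hL⟩ := hK.isBounded.subset_closedBall 0
  exact (integrableOn_radialKernel_affine hn hl y L).mono_set hL

/-- Monotonicity traps the regularized value between two fixed ones. This gives a majorant
independent of ε that is still locally integrable at the singularity. -/
theorem abs_radialKernel_add_le (n : ℕ) {s ε : ℝ} (hs : 0 < s) (h0 : 0 ≤ ε) (h1 : ε ≤ 1) :
    |radialKernel n (s + ε)| ≤ |radialKernel n s| + |radialKernel n (s + 1)| := by
  have a := monotoneOn_radialKernel n (a := s) (b := s + ε) hs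
    (show 0 < s + ε by positivity) (by linarith)
  have b := monotoneOn_radialKernel n (a := s + ε) (b := s + 1) (show 0 < s + ε by positivity)
    (show 0 < s + 1 by positivity) (by linarith)
  rw [abs_le]
  constructor
  · linarith [neg_abs_le (radialKernel n s), abs_nonneg (radialKernel n (s + 1))]
  · linarith [le_abs_self (radialKernel n (s + 1)), abs_nonneg (radialKernel n s)]

theorem ae_smul_sub_ne_zero {n : ℕ} (hn : 1 ≤ n) {l : ℝ} (hl : l ≠ 0)
    (y : EuclideanSpace ℝ (Fin n)) : ∀ᵐ x : EuclideanSpace ℝ (Fin n), l • x - y ≠ 0 := by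
  have : Nonempty (Fin n) := ⟨⟨0, hn⟩⟩
  filter_upwards [Measure.ae_ne volume (l⁻¹ • y)] with x hx h
  apply hx
  rw [sub_eq_zero] at h
  rw [← h, inv_smul_smul₀ hl]

theorem tendsto_integral_radialKernel_regularized {n : ℕ} (hn : 1 ≤ n) {l : ℝ} (hl : l ≠ 0)
    (y : EuclideanSpace ℝ (Fin n)) {ψ : EuclideanSpace ℝ (Fin n) → ℝ}
    (hψ : Continuous ψ) (hc : HasCompactSupport ψ) :
    Tendsto (fun δ : ℝ => ∫ x, radialKernel n (‖l • x - y‖ ^ 2 + δ ^ 2) * ψ x) (𝓝[>] 0)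
      (𝓝 (∫ x, radialKernel n (‖l • x - y‖ ^ 2) * ψ x)) := by
  have hδ : ∀ᶠ δ : ℝ in 𝓝[>] 0, 0 < δ ∧ δ < 1 :=
    Ioo_mem_nhdsGT (zero_lt_one' ℝ)
  refine tendsto_integral_filter_of_dominated_convergence
    (fun x => |radialKernel n (‖l • x - y‖ ^ 2) * ψ x| +
      |radialKernel n (‖l • x - y‖ ^ 2 + 1) * ψ x|) ?_ ?_ ?_ ?_
  · filter_upwards with δ
    have := measurable_radialKernel n
    exact ((this.comp (by fun_prop)).mul hψ.measurable).aestronglyMeasurable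
  · filter_upwards [hδ] with δ hδ
    filter_upwards [ae_smul_sub_ne_zero hn hl y] with x hx
    rw [Real.norm_eq_abs, abs_mul, abs_mul, abs_mul, ← add_mul]
    exact mul_le_mul_of_nonneg_right (abs_radialKernel_add_le n (by positivity) (sq_nonneg _)
      (by nlinarith [hδ.1, hδ.2])) (abs_nonneg _)
  · refine (integrable_radialKernel_mul hn hl y hψ hc).abs.add (Integrable.abs ?_)
    exact (((contDiff_radialKernel_regularized l 1 y one_pos).continuous).mul
      hψ).integrable_of_hasCompactSupport hc.mul_left
  · filter_upwards [ae_smul_sub_ne_zero hn hl y] with x hx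
    refine Tendsto.mul_const _ ?_
    have h : ContinuousAt (fun δ : ℝ => radialKernel n (‖l • x - y‖ ^ 2 + δ ^ 2)) 0 := by
      have h0 : 0 < ‖l • x - y‖ ^ 2 + (0 : ℝ) ^ 2 := by positivity
      exact (hasDerivAt_radialKernel n h0).continuousAt.comp
        (f := fun δ : ℝ => ‖l • x - y‖ ^ 2 + δ ^ 2) (by fun_prop)
    have h' := h.tendsto.mono_left (nhdsWithin_le_nhds (s := Ioi 0))
    simpa using h'

/-- Substitute w = l x, then w = δ z + y. The Jacobian δⁿ and the factor δ² exactly absorb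
(δ²)^(-n/2 - 1), so δ remains only in the argument of φ. -/
theorem integral_regularized_laplacian {n : ℕ} {l δ : ℝ} (hl : l ≠ 0) (hδ : 0 < δ)
    (y : EuclideanSpace ℝ (Fin n)) (φ : EuclideanSpace ℝ (Fin n) → ℝ) :
    ∫ x, 2 * n * δ ^ 2 * (‖l • x - y‖ ^ 2 + δ ^ 2) ^ (-(n / 2) - 1 : ℝ) * φ x =
      |(l ^ n)⁻¹| * ∫ z, 2 * n * (1 + ‖z‖ ^ 2) ^ (-(n + 2 : ℝ) / 2) *
        φ (l⁻¹ • (δ • z + y)) := by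
  set W : EuclideanSpace ℝ (Fin n) → ℝ := fun w =>
    2 * n * δ ^ 2 * (‖w - y‖ ^ 2 + δ ^ 2) ^ (-(n / 2) - 1 : ℝ) * φ (l⁻¹ • w) with hW
  have h1 : ∫ x, W (l • x) = |(l ^ n)⁻¹| * ∫ w, W w := by
    simpa using Measure.integral_comp_smul volume W l
  have h2 : ∫ w, W (w + y) = ∫ w, W w := integral_add_right_eq_self W y
  have h3 : ∫ z, W (δ • z + y) = |(δ ^ n)⁻¹| * ∫ w, W (w + y) := by
    simpa using Measure.integral_comp_smul volume (fun w => W (w + y)) δ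
  have hδn : (δ ^ n) ≠ 0 := by positivity
  rw [abs_of_pos (by positivity), h2] at h3
  have h4 : ∫ w, W w = ∫ z, δ ^ n * W (δ • z + y) := by
    rw [integral_const_mul, h3, mul_inv_cancel_left₀ hδn]
  have h5 : ∀ x, W (l • x) =
      2 * n * δ ^ 2 * (‖l • x - y‖ ^ 2 + δ ^ 2) ^ (-(n / 2) - 1 : ℝ) * φ x := by
    intro x
    simp [hW, inv_smul_smul₀ hl]
  simp_rw [h5] at h1
  rw [h1, h4]
  congr 1
  refine integral_congr_ae (Eventually.of_forall fun z => ?_)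
  simp only [hW, add_sub_cancel_right, norm_smul, Real.norm_eq_abs, abs_of_pos hδ]
  have e1 : (δ * ‖z‖) ^ 2 + δ ^ 2 = δ ^ 2 * (1 + ‖z‖ ^ 2) := by ring
  have e2 : (δ ^ 2) ^ (-(n / 2) - 1 : ℝ) = (δ ^ n)⁻¹ * (δ ^ 2)⁻¹ := by
    rw [Real.rpow_sub_one (by positivity), Real.rpow_neg (by positivity), ← Real.rpow_natCast δ 2,
      ← Real.rpow_mul hδ.le]
    congr 2
    rw [← Real.rpow_natCast]
    congr 1
    push_cast
    ring
  rw [e1, Real.mul_rpow (by positivity) (by positivity), e2,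
    show (-(n / 2) - 1 : ℝ) = -(n + 2) / 2 by ring]
  field_simp

theorem tendsto_integral_regularized_laplacian {n : ℕ} (l : ℝ)
    (y : EuclideanSpace ℝ (Fin n)) {φ : EuclideanSpace ℝ (Fin n) → ℝ}
    (hφ : Continuous φ) (hc : HasCompactSupport φ) :
    Tendsto (fun δ : ℝ => ∫ z : EuclideanSpace ℝ (Fin n),
      2 * n * (1 + ‖z‖ ^ 2) ^ (-(n + 2 : ℝ) / 2) * φ (l⁻¹ • (δ • z + y))) (𝓝[>] 0)
      (𝓝 (radialKernelMass n * φ (l⁻¹ • y))) := by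
  obtain ⟨C, hC⟩ := hφ.bounded_above_of_compact_support hc
  rw [radialKernelMass, ← integral_mul_const]
  refine tendsto_integral_filter_of_dominated_convergence
    (fun z => 2 * n * (1 + ‖z‖ ^ 2) ^ (-(n + 2 : ℝ) / 2) * C) ?_ ?_
    ((integrable_radialKernelMass n).mul_const C) ?_
  · filter_upwards with δ
    exact (integrable_radialKernelMass n).aestronglyMeasurable.mul
      (hφ.comp (by fun_prop)).aestronglyMeasurable
  · filter_upwards with δ
    filter_upwards with z
    rw [norm_mul, Real.norm_of_nonneg (by positivity)]
    exact mul_le_mul_of_nonneg_left (hC _) (by positivity)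
  · filter_upwards with z
    refine Tendsto.const_mul _ ?_
    have h : Continuous fun δ : ℝ => φ (l⁻¹ • (δ • z + y)) := hφ.comp (by fun_prop)
    simpa using (h.tendsto 0).mono_left (nhdsWithin_le_nhds (s := Ioi 0))

/-- `radialKernel n (‖x‖ ^ 2)` is a multiple of the fundamental solution of the Laplacian; the
statement includes the rescaled and translated versions. -/
theorem integral_radialKernel_mul_laplacian {n : ℕ} (hn : 1 ≤ n) {l : ℝ} (hl : l ≠ 0)
    (y : EuclideanSpace ℝ (Fin n)) {φ : EuclideanSpace ℝ (Fin n) → ℝ}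
    (hφ : ContDiff ℝ ∞ φ) (hc : HasCompactSupport φ) :
    ∫ x, radialKernel n (‖l • x - y‖ ^ 2) * (Δ φ) x =
      l ^ 2 * |(l ^ n)⁻¹| * (radialKernelMass n * φ (l⁻¹ • y)) := by
  have h1 := tendsto_integral_radialKernel_regularized hn hl y
    (continuous_laplacian (hφ.of_le (by norm_cast))) (hasCompactSupport_laplacian hc)
  have h2 := (tendsto_integral_regularized_laplacian l y hφ.continuous hc).const_mul
    (l ^ 2 * |(l ^ n)⁻¹|)
  refine tendsto_nhds_unique h1 (h2.congr' ?_)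
  filter_upwards [self_mem_nhdsWithin] with δ hδ
  rw [integral_radialKernel_regularized l (δ ^ 2) y (pow_pos hδ 2) hφ hc,
    integral_regularized_laplacian hl hδ, mul_assoc]

/-! ### Holomorphic extension and Taylor coefficients -/

/-- The holomorphic extension of `radialKernel n` to the slit plane. -/
noncomputable def complexRadialKernel (n : ℕ) (z : ℂ) : ℂ :=
  if n = 2 then Complex.log z else z ^ (1 - n / 2 : ℂ) / (1 - n / 2)

theorem complexRadialKernel_ofReal (n : ℕ) {s : ℝ} (hs : 0 ≤ s) :
    complexRadialKernel n s = radialKernel n s := by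
  unfold complexRadialKernel radialKernel
  split_ifs
  · rw [Complex.ofReal_log hs]
  · push_cast [Complex.ofReal_cpow hs]
    rfl

theorem differentiableAt_complexRadialKernel (n : ℕ) {z : ℂ} (hz : z ∈ Complex.slitPlane) :
    DifferentiableAt ℂ (complexRadialKernel n) z := by
  unfold complexRadialKernel
  split_ifs
  · exact Complex.differentiableAt_log hz
  · exact (differentiableAt_id.cpow_const hz).div_const _

theorem measurable_complexRadialKernel (n : ℕ) : Measurable (complexRadialKernel n) := by
  unfold complexRadialKernel
  split_ifs
  · exact Complex.measurable_log
  · fun_prop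

theorem exists_bound_complexRadialKernel (n : ℕ) {a : ℝ} (ha : 0 < a) (b : ℝ) :
    ∃ M, 0 ≤ M ∧ ∀ z : ℂ, a ≤ z.re → ‖z‖ ≤ b → ‖complexRadialKernel n z‖ ≤ M := by
  have hK : IsCompact ({z : ℂ | a ≤ z.re} ∩ Metric.closedBall 0 b) :=
    (isCompact_closedBall 0 b).inter_left (isClosed_le continuous_const Complex.continuous_re)
  have hc : ContinuousOn (complexRadialKernel n) ({z : ℂ | a ≤ z.re} ∩ Metric.closedBall 0 b) :=
    fun z hz => (differentiableAt_complexRadialKernel n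
      (Or.inl (ha.trans_le hz.1))).continuousAt.continuousWithinAt
  obtain ⟨M, hM⟩ := hK.exists_bound_of_continuousOn hc
  exact ⟨max M 0, le_max_right _ _, fun z h1 h2 =>
    (hM z ⟨h1, mem_closedBall_zero_iff.2 h2⟩).trans (le_max_left _ _)⟩

section Taylor

variable {n : ℕ}

/-- The complexification in `l` of `‖l • x - y‖ ^ 2`. -/
noncomputable def complexNormSq (x y : EuclideanSpace ℝ (Fin n)) (l : ℂ) : ℂ :=
  ‖y‖ ^ 2 - 2 * l * (inner ℝ x y : ℝ) + l ^ 2 * ‖x‖ ^ 2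

theorem complexNormSq_ofReal (x y : EuclideanSpace ℝ (Fin n)) (l : ℝ) :
    complexNormSq x y l = (‖l • x - y‖ ^ 2 : ℝ) := by
  rw [norm_sub_sq_real, norm_smul, mul_pow, Real.norm_eq_abs, sq_abs, inner_smul_left]
  simp [complexNormSq]
  ring

/-- A radius on which `l ↦ complexNormSq x y l` stays well inside the right half-plane. -/
noncomputable def taylorRadius (x y : EuclideanSpace ℝ (Fin n)) : ℝ := ‖y‖ / (4 * (‖x‖ + 1))

theorem taylorRadius_pos (x : EuclideanSpace ℝ (Fin n)) {y : EuclideanSpace ℝ (Fin n)}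
    (hy : y ≠ 0) : 0 < taylorRadius x y := by
  unfold taylorRadius
  positivity

/-- The radius forces ‖l‖ ‖x‖ ≤ ‖y‖ / 4, and 2 · 1/4 + (1/4)² = 9/16. Being below 1, this keeps the
values off the branch cut. -/
theorem norm_complexNormSq_sub_le {x y : EuclideanSpace ℝ (Fin n)} {l : ℂ}
    (hl : ‖l‖ ≤ taylorRadius x y) :
    ‖complexNormSq x y l - (‖y‖ ^ 2 : ℝ)‖ ≤ 9 / 16 * ‖y‖ ^ 2 := by
  rw [taylorRadius, le_div_iff₀ (by positivity)] at hl
  have h1 : ‖l‖ * ‖x‖ ≤ ‖y‖ / 4 := by nlinarith [norm_nonneg l, norm_nonneg x]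
  have h2 : complexNormSq x y l - (‖y‖ ^ 2 : ℝ) =
      -(2 * l * (inner ℝ x y : ℝ)) + (l * ‖x‖) ^ 2 := by
    simp [complexNormSq]
    ring
  have h3 := abs_real_inner_le_norm x y
  rw [h2]
  refine (norm_add_le _ _).trans ?_
  simp only [norm_neg, norm_mul, norm_pow, Complex.norm_real, Real.norm_eq_abs, abs_norm,
    Complex.norm_two]
  have h4 : 2 * ‖l‖ * |inner ℝ x y| ≤ 2 * (‖y‖ / 4) * ‖y‖ := by
    calc 2 * ‖l‖ * |inner ℝ x y| ≤ 2 * ‖l‖ * (‖x‖ * ‖y‖) := by gcongr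
      _ = 2 * (‖l‖ * ‖x‖) * ‖y‖ := by ring
      _ ≤ _ := by gcongr
  have h5 : (‖l‖ * ‖x‖) ^ 2 ≤ (‖y‖ / 4) ^ 2 := by gcongr
  linarith [h4, h5]

theorem re_complexNormSq_ge {x y : EuclideanSpace ℝ (Fin n)} {l : ℂ}
    (hl : ‖l‖ ≤ taylorRadius x y) : 7 / 16 * ‖y‖ ^ 2 ≤ (complexNormSq x y l).re := by
  have h := (Complex.abs_re_le_norm _).trans (norm_complexNormSq_sub_le hl)
  rw [Complex.sub_re, Complex.ofReal_re, abs_le] at h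
  linarith [h.1]

theorem norm_complexNormSq_le {x y : EuclideanSpace ℝ (Fin n)} {l : ℂ}
    (hl : ‖l‖ ≤ taylorRadius x y) : ‖complexNormSq x y l‖ ≤ 25 / 16 * ‖y‖ ^ 2 := by
  have h := norm_sub_norm_le (complexNormSq x y l) (‖y‖ ^ 2 : ℝ)
  rw [Complex.norm_real, Real.norm_of_nonneg (by positivity)] at h
  linarith [norm_complexNormSq_sub_le hl]

/-- The `k`-th coefficient of the expansion of `radialKernel n (‖l • x - y‖ ^ 2)` in powers of `l`,
that is, the homogeneous Taylor polynomial of degree `k` in `x`. -/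
noncomputable def kernelCoeff (k : ℕ) (x y : EuclideanSpace ℝ (Fin n)) : ℝ :=
  (cauchyPowerSeries (fun l => complexRadialKernel n (complexNormSq x y l)) 0
    (taylorRadius x y) k fun _ => 1).re

theorem hasSum_kernelCoeff {x y : EuclideanSpace ℝ (Fin n)} (hy : y ≠ 0) {l : ℝ}
    (hl : |l| < taylorRadius x y) :
    HasSum (fun k => l ^ k * kernelCoeff k x y) (radialKernel n (‖l • x - y‖ ^ 2)) := by
  have hr := taylorRadius_pos x hy
  have hd : DifferentiableOn ℂ (fun l => complexRadialKernel n (complexNormSq x y l))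
      (Metric.closedBall 0 (NNReal.mk (taylorRadius x y) hr.le)) := by
    intro z hz
    have hz' : ‖z‖ ≤ taylorRadius x y := by simpa using hz
    have h1 : DifferentiableAt ℂ (complexRadialKernel n) (complexNormSq x y z) := by
      refine differentiableAt_complexRadialKernel n (Or.inl ?_)
      exact lt_of_lt_of_le (by positivity) (re_complexNormSq_ge hz')
    have h2 : DifferentiableAt ℂ (complexNormSq x y) z := by
      unfold complexNormSq
      fun_prop
    exact (h1.comp z h2).differentiableWithinAt
  have hs := (hd.hasFPowerSeriesOnBall hr).hasSum (y := (l : ℂ)) (by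
    rw [Metric.mem_eball, edist_zero_right]
    rw [enorm_lt_coe, ← NNReal.coe_lt_coe]
    simpa using hl)
  rw [zero_add, complexNormSq_ofReal, complexRadialKernel_ofReal n (by positivity)] at hs
  have := Complex.hasSum_re hs
  rw [Complex.ofReal_re] at this
  convert! this using 2 with k
  rw [kernelCoeff, ← Complex.re_ofReal_mul, Complex.ofReal_pow]
  congr 1
  -- Multilinearity turns the value at (l, …, l) into lᵏ times the value at (1, …, 1).
  have := (cauchyPowerSeries (fun l => complexRadialKernel n (complexNormSq x y l)) 0
    (taylorRadius x y) k).map_smul_univ (fun _ => (l : ℂ)) (fun _ => 1)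
  simp only [smul_eq_mul, mul_one, Finset.prod_const, Finset.card_univ, Fintype.card_fin] at this
  exact this.symm

/-- Cauchy's estimate on the circle of radius `taylorRadius x y`, whose image lies in the region
where `M` is a bound. -/
theorem abs_kernelCoeff_le {M : ℝ} (k : ℕ) {x y : EuclideanSpace ℝ (Fin n)} (hy : y ≠ 0)
    (hM : ∀ z : ℂ, 7 / 16 * ‖y‖ ^ 2 ≤ z.re → ‖z‖ ≤ 25 / 16 * ‖y‖ ^ 2 →
      ‖complexRadialKernel n z‖ ≤ M) :
    |kernelCoeff k x y| ≤ M * (4 * (‖x‖ + 1) / ‖y‖) ^ k := by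
  have hr := taylorRadius_pos x hy
  refine (Complex.abs_re_le_norm _).trans ((ContinuousMultilinearMap.le_opNorm _ _).trans ?_)
  simp only [norm_one, Finset.prod_const_one, mul_one]
  refine (norm_cauchyPowerSeries_le _ _ _ _).trans ?_
  rw [abs_of_pos hr, show (taylorRadius x y)⁻¹ = 4 * (‖x‖ + 1) / ‖y‖ from inv_div _ _]
  refine mul_le_mul_of_nonneg_right ?_ (by positivity)
  have h := intervalIntegral.norm_integral_le_of_norm_le_const (a := 0) (b := 2 * Real.pi) (C := M)
    (f := fun θ => ‖complexRadialKernel n (complexNormSq x y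
      (circleMap 0 (taylorRadius x y) θ))‖) (fun θ _ => by
      have : ‖circleMap 0 (taylorRadius x y) θ‖ ≤ taylorRadius x y := by
        rw [norm_circleMap_zero, abs_of_pos hr]
      rw [norm_norm]
      exact hM _ (re_complexNormSq_ge this) (norm_complexNormSq_le this))
  rw [sub_zero, abs_of_pos Real.two_pi_pos] at h
  have h' := (le_abs_self _).trans h
  rw [inv_mul_le_iff₀ Real.two_pi_pos]
  linarith

/-- The coefficient is a circle integral depending measurably on parameters, the radius included.
Joint measurability is needed for Fubini. -/
theorem measurable_kernelCoeff (k : ℕ) :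
    Measurable fun p : EuclideanSpace ℝ (Fin n) × EuclideanSpace ℝ (Fin n) =>
      kernelCoeff k p.1 p.2 := by
  unfold kernelCoeff
  simp_rw [cauchyPowerSeries_apply, circleIntegral, intervalIntegral.integral_of_le
    Real.two_pi_pos.le, deriv_circleMap]
  refine Complex.measurable_re.comp ((measurable_const_smul (2 * (Real.pi : ℂ) * Complex.I)⁻¹).comp
    (?_ : Measurable fun p : EuclideanSpace ℝ (Fin n) × EuclideanSpace ℝ (Fin n) => _))
  refine (StronglyMeasurable.integral_prod_right' (f := fun q : (EuclideanSpace ℝ (Fin n) ×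
    EuclideanSpace ℝ (Fin n)) × ℝ => (circleMap 0 (taylorRadius q.1.1 q.1.2) q.2 * Complex.I) •
      ((1 / (circleMap 0 (taylorRadius q.1.1 q.1.2) q.2 - 0)) ^ k •
        (circleMap 0 (taylorRadius q.1.1 q.1.2) q.2 - 0)⁻¹ •
          complexRadialKernel n (complexNormSq q.1.1 q.1.2
            (circleMap 0 (taylorRadius q.1.1 q.1.2) q.2)))) ?_).measurable
  have h1 : Measurable fun q : (EuclideanSpace ℝ (Fin n) × EuclideanSpace ℝ (Fin n)) × ℝ =>
      circleMap 0 (taylorRadius q.1.1 q.1.2) q.2 := by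
    unfold circleMap taylorRadius
    fun_prop
  have h2 : Measurable fun q : (EuclideanSpace ℝ (Fin n) × EuclideanSpace ℝ (Fin n)) × ℝ =>
      complexRadialKernel n (complexNormSq q.1.1 q.1.2
            (circleMap 0 (taylorRadius q.1.1 q.1.2) q.2)) := by
    refine (measurable_complexRadialKernel n).comp ?_
    unfold complexNormSq
    have : Measurable fun q : (EuclideanSpace ℝ (Fin n) × EuclideanSpace ℝ (Fin n)) × ℝ =>
      (inner ℝ q.1.1 q.1.2 : ℝ) := by fun_prop
    fun_prop
  refine Measurable.stronglyMeasurable ?_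
  fun_prop

attribute [irreducible] kernelCoeff

end Taylor

/-! ### Weak harmonicity of the Taylor coefficients -/

/-- Identity theorem. Vanishing is asked only for l ≠ 0, since the change of variables behind the
application breaks down at l = 0. -/
theorem eq_zero_of_hasSum_pow_mul {c : ℕ → ℝ} {F : ℝ → ℝ} {r : ℝ} (hr : 0 < r)
    (hF : ∀ l, |l| < r → HasSum (fun k => l ^ k * c k) (F l))
    (h0 : ∀ l, l ≠ 0 → |l| < r → F l = 0) (k : ℕ) : c k = 0 := by
  have hev : ∀ᶠ l : ℝ in 𝓝 0, |l| < r := by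
    filter_upwards [Metric.ball_mem_nhds (0 : ℝ) hr] with l hl
    simpa using hl
  have hp : HasFPowerSeriesAt F (FormalMultilinearSeries.ofScalars ℝ c) 0 := by
    rw [hasFPowerSeriesAt_iff]
    filter_upwards [hev] with l hl
    simpa [FormalMultilinearSeries.coeff_ofScalars] using hF l hl
  have hz : ∀ᶠ l in 𝓝 (0 : ℝ), F l = 0 := by
    rw [← hp.analyticAt.frequently_zero_iff_eventually_zero]
    refine Eventually.frequently ?_
    filter_upwards [hev.filter_mono nhdsWithin_le_nhds, self_mem_nhdsWithin] with l hl hl0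
    exact h0 l hl0 hl
  have h := (hp.congr hz).eq_zero
  have h' := congrArg (fun p => FormalMultilinearSeries.coeff p k) h
  rw [FormalMultilinearSeries.coeff_ofScalars] at h'
  simpa [FormalMultilinearSeries.coeff] using h'

variable {n : ℕ}

theorem exists_bound_near_norm_sq (n : ℕ) {a : ℝ} (ha : 0 < a) (b : ℝ) :
    ∃ M, 0 ≤ M ∧ ∀ y : EuclideanSpace ℝ (Fin n), a ≤ ‖y‖ → ‖y‖ ≤ b →
      ∀ z : ℂ, 7 / 16 * ‖y‖ ^ 2 ≤ z.re → ‖z‖ ≤ 25 / 16 * ‖y‖ ^ 2 →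
        ‖complexRadialKernel n z‖ ≤ M := by
  obtain ⟨M, hM, h⟩ := exists_bound_complexRadialKernel n (a := 7 / 16 * a ^ 2) (by positivity)
    (25 / 16 * b ^ 2)
  refine ⟨M, hM, fun y h1 h2 z hz hz' => h z (le_trans ?_ hz) (hz'.trans ?_)⟩ <;> gcongr

theorem measurable_kernelCoeff_left (k : ℕ) (y : EuclideanSpace ℝ (Fin n)) :
    Measurable fun x => kernelCoeff k x y :=
  Measurable.of_uncurry_right (f := kernelCoeff k) (measurable_kernelCoeff k)

/-- The bound on |l| is half the least Taylor radius over ‖x‖ ≤ L. The Cauchy estimate then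
dominates the k-th term by 2⁻ᵏ M |ψ|, and the sum and integral can be exchanged. -/
theorem hasSum_integral_kernelCoeff {y : EuclideanSpace ℝ (Fin n)} (hy : y ≠ 0)
    {ψ : EuclideanSpace ℝ (Fin n) → ℝ} (hψ : Continuous ψ) (hc : HasCompactSupport ψ) {L l : ℝ}
    (hL : 0 ≤ L) (hs : ∀ x, L < ‖x‖ → ψ x = 0) (hl : |l| < ‖y‖ / (8 * (L + 1))) :
    HasSum (fun k => l ^ k * ∫ x, kernelCoeff k x y * ψ x)
      (∫ x, radialKernel n (‖l • x - y‖ ^ 2) * ψ x) := by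
  obtain ⟨M, hM, hb⟩ := exists_bound_near_norm_sq n (norm_pos_iff.2 hy) ‖y‖
  have hy' : 0 < ‖y‖ := norm_pos_iff.2 hy
  have hbd : ∀ k x, ‖l ^ k * (kernelCoeff k x y * ψ x)‖ ≤ (1 / 2) ^ k * (M * |ψ x|) := by
    intro k x
    by_cases hx : L < ‖x‖
    · simp [hs x hx]
    rw [norm_mul, norm_mul, norm_pow, Real.norm_eq_abs, Real.norm_eq_abs, Real.norm_eq_abs,
      ← mul_assoc, ← mul_assoc]
    refine mul_le_mul_of_nonneg_right ?_ (abs_nonneg _)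
    calc |l| ^ k * |kernelCoeff k x y|
        ≤ (‖y‖ / (8 * (L + 1))) ^ k * (M * (4 * (L + 1) / ‖y‖) ^ k) := by
          gcongr
          refine (abs_kernelCoeff_le k hy (hb y le_rfl le_rfl)).trans ?_
          gcongr
          exact not_lt.1 hx
      _ = (‖y‖ / (8 * (L + 1)) * (4 * (L + 1) / ‖y‖)) ^ k * M := by rw [mul_pow]; ring
      _ = (1 / 2) ^ k * M := by
          congr 2
          field_simp
          norm_num
  simp_rw [← integral_const_mul]
  refine hasSum_integral_of_dominated_convergence
    (fun k x => (1 / 2) ^ k * (M * |ψ x|)) ?_ ?_ ?_ ?_ ?_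
  · exact fun k => (((measurable_kernelCoeff_left k y).mul hψ.measurable).const_mul
      _).aestronglyMeasurable
  · exact fun k => Eventually.of_forall fun x => hbd k x
  · exact Eventually.of_forall fun x => summable_geometric_two.mul_right _
  · simp_rw [tsum_mul_right]
    exact (((hψ.integrable_of_hasCompactSupport hc).abs).const_mul _).const_mul _
  · refine Eventually.of_forall fun x => ?_
    by_cases hx : L < ‖x‖
    · simp [hs x hx, hasSum_zero]
    simp_rw [← mul_assoc]
    refine (hasSum_kernelCoeff hy (hl.trans_le ?_)).mul_right _
    unfold taylorRadius
    have := not_lt.1 hx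
    gcongr
    linarith

theorem exists_radius_of_hasCompactSupport {φ : EuclideanSpace ℝ (Fin n) → ℝ}
    (hc : HasCompactSupport φ) :
    ∃ L, 0 ≤ L ∧ (∀ x, L < ‖x‖ → φ x = 0) ∧ ∀ x, L < ‖x‖ → (Δ φ) x = 0 := by
  have key : ∀ ψ : EuclideanSpace ℝ (Fin n) → ℝ, HasCompactSupport ψ →
      ∃ L, 0 ≤ L ∧ ∀ x, L < ‖x‖ → ψ x = 0 := by
    intro ψ hψ
    obtain ⟨L, hL⟩ := hψ.isCompact.isBounded.subset_closedBall 0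
    refine ⟨max L 0, le_max_right _ _, fun x hx => image_eq_zero_of_notMem_tsupport fun h => ?_⟩
    have := mem_closedBall_zero_iff.1 (hL h)
    exact absurd (this.trans (le_max_left L 0)) (not_le.2 hx)
  obtain ⟨L1, h1, h1'⟩ := key φ hc
  obtain ⟨L2, h2, h2'⟩ := key _ (hasCompactSupport_laplacian hc)
  exact ⟨max L1 L2, h1.trans (le_max_left _ _),
    fun x hx => h1' x ((le_max_left _ _).trans_lt hx),
    fun x hx => h2' x ((le_max_right _ _).trans_lt hx)⟩

/-- The Taylor polynomials of the fundamental solution are weakly harmonic on the whole space. -/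
theorem integral_kernelCoeff_mul_laplacian (hn : 1 ≤ n) (k : ℕ) {y : EuclideanSpace ℝ (Fin n)}
    (hy : y ≠ 0) {φ : EuclideanSpace ℝ (Fin n) → ℝ}
    (hφ : ContDiff ℝ ∞ φ) (hc : HasCompactSupport φ) :
    ∫ x, kernelCoeff k x y * (Δ φ) x = 0 := by
  obtain ⟨L, hL, hs, hs'⟩ := exists_radius_of_hasCompactSupport hc
  have hy' : 0 < ‖y‖ := norm_pos_iff.2 hy
  have hF : ∀ l : ℝ, |l| < ‖y‖ / (8 * (L + 1)) →
      HasSum (fun k => l ^ k * ∫ x, kernelCoeff k x y * (Δ φ) x)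
        (∫ x, radialKernel n (‖l • x - y‖ ^ 2) * (Δ φ) x) := fun l hl =>
    hasSum_integral_kernelCoeff hy (continuous_laplacian (hφ.of_le (by norm_cast)))
      (hasCompactSupport_laplacian hc) hL hs' hl
  have h0 : ∀ l : ℝ, l ≠ 0 → |l| < ‖y‖ / (8 * (L + 1)) →
      ∫ x, radialKernel n (‖l • x - y‖ ^ 2) * (Δ φ) x = 0 := by
    intro l hl0 hl
    -- For such l the point y / l has norm greater than L, outside the support of φ.
    rw [integral_radialKernel_mul_laplacian hn hl0 y hφ hc, hs, mul_zero, mul_zero]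
    rw [norm_smul, norm_inv, Real.norm_eq_abs, ← div_eq_inv_mul, lt_div_iff₀ (abs_pos.2 hl0)]
    rw [lt_div_iff₀ (by positivity)] at hl
    nlinarith [abs_nonneg l]
  have hr : 0 < ‖y‖ / (8 * (L + 1)) := by positivity
  obtain ⟨c, hk⟩ : ∃ c : ℕ → ℝ, ∀ k, ∫ x, kernelCoeff k x y * (Δ φ) x = c k := ⟨_, fun _ => rfl⟩
  simp only [hk] at hF ⊢
  exact eq_zero_of_hasSum_pow_mul hr hF h0 k

/-! ### The corrected kernel and its bounds -/

/-- The fundamental solution with pole at `y`, corrected by a harmonic Taylor polynomial whose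
degree depends on the integer part of `‖y‖`. -/
noncomputable def correctedKernel (N : ℕ → ℕ) (x y : EuclideanSpace ℝ (Fin n)) : ℝ :=
  radialKernel n (‖x - y‖ ^ 2) - ∑ j ∈ Finset.range (N ⌊‖y‖⌋₊), kernelCoeff j x y

/-- The number of terms depends on y only through a measurable map to ℕ, so it can be frozen and
each value treated separately. -/
theorem measurable_correctedKernel (N : ℕ → ℕ) :
    Measurable fun p : EuclideanSpace ℝ (Fin n) × EuclideanSpace ℝ (Fin n) =>
      correctedKernel N p.1 p.2 := by
  have h1 : Measurable fun q : ℕ × (EuclideanSpace ℝ (Fin n) × EuclideanSpace ℝ (Fin n)) =>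
      ∑ j ∈ Finset.range (N q.1), kernelCoeff j q.2.1 q.2.2 := by
    refine measurable_from_prod_countable_right fun k => ?_
    exact Finset.measurable_sum (Finset.range (N k)) fun j _ => measurable_kernelCoeff j
  have h2 : Measurable fun p : EuclideanSpace ℝ (Fin n) × EuclideanSpace ℝ (Fin n) =>
      (⌊‖p.2‖⌋₊, p) := by
    have : Measurable fun p : EuclideanSpace ℝ (Fin n) × EuclideanSpace ℝ (Fin n) => ⌊‖p.2‖⌋₊ :=
      Nat.measurable_floor.comp (by fun_prop)
    fun_prop
  have h3 : Measurable fun p : EuclideanSpace ℝ (Fin n) × EuclideanSpace ℝ (Fin n) =>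
      radialKernel n (‖p.1 - p.2‖ ^ 2) := (measurable_radialKernel n).comp (by fun_prop)
  exact h3.sub (h1.comp h2)

theorem integrableOn_radialKernel_sub (hn : 1 ≤ n) (y : EuclideanSpace ℝ (Fin n)) (L : ℝ) :
    IntegrableOn (fun x => radialKernel n (‖x - y‖ ^ 2)) (Metric.closedBall 0 L) := by
  simpa using integrableOn_radialKernel_affine hn one_ne_zero y L

theorem integrableOn_kernelCoeff (j : ℕ) {y : EuclideanSpace ℝ (Fin n)} (hy : y ≠ 0) (L : ℝ) :
    IntegrableOn (fun x => kernelCoeff j x y) (Metric.closedBall 0 L) := by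
  obtain ⟨M, hM, hb⟩ := exists_bound_near_norm_sq n (norm_pos_iff.2 hy) ‖y‖
  refine IntegrableOn.of_bound (isCompact_closedBall _ _).measure_lt_top
    (measurable_kernelCoeff_left j y).aestronglyMeasurable (M * (4 * (L + 1) / ‖y‖) ^ j) ?_
  filter_upwards [ae_restrict_mem Metric.isClosed_closedBall.measurableSet] with x hx
  refine (abs_kernelCoeff_le j hy (hb y le_rfl le_rfl)).trans ?_
  have := mem_closedBall_zero_iff.1 hx
  gcongr

theorem integrableOn_correctedKernel (hn : 1 ≤ n) (N : ℕ → ℕ) {y : EuclideanSpace ℝ (Fin n)}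
    (hy : y ≠ 0) (L : ℝ) :
    IntegrableOn (fun x => correctedKernel N x y) (Metric.closedBall 0 L) :=
  (integrableOn_radialKernel_sub hn y L).sub
    (integrable_finsetSum _ fun j _ => integrableOn_kernelCoeff j hy L)

/-- The correction does not destroy the fundamental solution property. -/
theorem integral_correctedKernel_mul_laplacian (hn : 1 ≤ n) (N : ℕ → ℕ)
    {y : EuclideanSpace ℝ (Fin n)} (hy : y ≠ 0) {φ : EuclideanSpace ℝ (Fin n) → ℝ}
    (hφ : ContDiff ℝ ∞ φ) (hc : HasCompactSupport φ) :
    ∫ x, correctedKernel N x y * (Δ φ) x = radialKernelMass n * φ y := by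
  have hψ := continuous_laplacian (hφ.of_le (by norm_cast) : ContDiff ℝ 2 φ)
  have hψc := hasCompactSupport_laplacian hc
  have h1 : Integrable fun x => radialKernel n (‖x - y‖ ^ 2) * (Δ φ) x := by
    simpa using integrable_radialKernel_mul hn one_ne_zero y hψ hψc
  have h2 : ∀ j, Integrable fun x => kernelCoeff j x y * (Δ φ) x := by
    intro j
    have h : LocallyIntegrable (fun x => kernelCoeff j x y) volume := by
      rw [locallyIntegrable_iff]
      intro K hK
      obtain ⟨L, hL⟩ := hK.isBounded.subset_closedBall 0
      exact (integrableOn_kernelCoeff j hy L).mono_set hL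
    exact h.integrable_smul_right_of_hasCompactSupport hψ hψc
  simp_rw [correctedKernel, sub_mul, Finset.sum_mul]
  rw [integral_sub h1 (integrable_finsetSum _ fun j _ => h2 j),
    integral_finsetSum _ fun j _ => h2 j]
  rw [Finset.sum_eq_zero fun j _ => integral_kernelCoeff_mul_laplacian hn j hy hφ hc, sub_zero]
  simpa using integral_radialKernel_mul_laplacian hn one_ne_zero y hφ hc

/-- Here l = 1 lies within the Taylor radius, so the corrected kernel is the tail of the expansion.
Successive bounds have ratio at most 1/2, and the geometric series contributes the factor 2. -/
theorem abs_correctedKernel_le {M : ℝ} (N : ℕ → ℕ) {x y : EuclideanSpace ℝ (Fin n)} (hM : 0 ≤ M)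
    (hy : y ≠ 0) (hb : ∀ z : ℂ, 7 / 16 * ‖y‖ ^ 2 ≤ z.re → ‖z‖ ≤ 25 / 16 * ‖y‖ ^ 2 →
      ‖complexRadialKernel n z‖ ≤ M) (hx : 8 * (‖x‖ + 1) ≤ ‖y‖) :
    |correctedKernel N x y| ≤ 2 * M * (1 / 2) ^ N ⌊‖y‖⌋₊ := by
  have hy' : 0 < ‖y‖ := norm_pos_iff.2 hy
  have hl : |(1 : ℝ)| < taylorRadius x y := by
    rw [abs_one, taylorRadius, lt_div_iff₀ (by positivity)]
    linarith [norm_nonneg x]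
  have h := hasSum_kernelCoeff hy hl
  simp only [one_pow, one_mul, one_smul] at h
  have h1 := (hasSum_nat_add_iff' (N ⌊‖y‖⌋₊)).2 h
  have h2 : HasSum (fun j => (1 / 2 : ℝ) ^ j * (M * (1 / 2) ^ N ⌊‖y‖⌋₊))
      (2 * (M * (1 / 2) ^ N ⌊‖y‖⌋₊)) := hasSum_geometric_two.mul_right _
  have h3 := h1.norm_le_of_bounded h2 fun j => by
    refine (abs_kernelCoeff_le _ hy hb).trans ?_
    have : 4 * (‖x‖ + 1) / ‖y‖ ≤ 1 / 2 := by
      rw [div_le_iff₀ hy']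
      linarith
    calc M * (4 * (‖x‖ + 1) / ‖y‖) ^ (j + N ⌊‖y‖⌋₊) ≤ M * (1 / 2) ^ (j + N ⌊‖y‖⌋₊) := by gcongr
      _ = _ := by rw [pow_add]; ring
  rw [mul_assoc]
  exact h3

theorem setIntegral_abs_radialKernel_sub_le (hn : 1 ≤ n) {L R : ℝ} {y : EuclideanSpace ℝ (Fin n)}
    (hR : L + ‖y‖ < R) :
    ∫ x in Metric.closedBall 0 L, |radialKernel n (‖x - y‖ ^ 2)| ≤
      ∫ z in Metric.ball (0 : EuclideanSpace ℝ (Fin n)) R, |radialKernel n (‖z‖ ^ 2)| := by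
  have hm : MeasurableSet (Metric.ball (0 : EuclideanSpace ℝ (Fin n)) R) :=
    Metric.isOpen_ball.measurableSet
  set h : EuclideanSpace ℝ (Fin n) → ℝ :=
    (Metric.ball 0 R).indicator fun z => |radialKernel n (‖z‖ ^ 2)| with hh
  have hi : Integrable h :=
    (integrable_indicator_iff hm).2 (integrableOn_radialKernel_norm_sq hn R).abs
  have h0 : ∀ z, 0 ≤ h z := fun z => indicator_nonneg (fun _ _ => abs_nonneg _) _
  calc ∫ x in Metric.closedBall 0 L, |radialKernel n (‖x - y‖ ^ 2)|
      = ∫ x in Metric.closedBall 0 L, h (x - y) := by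
        refine setIntegral_congr_fun Metric.isClosed_closedBall.measurableSet fun x hx => ?_
        have hx' : x - y ∈ Metric.ball (0 : EuclideanSpace ℝ (Fin n)) R := by
          rw [mem_ball_zero_iff]
          have := mem_closedBall_zero_iff.1 hx
          linarith [norm_sub_le x y]
        simp [hh, indicator_of_mem hx']
    _ ≤ ∫ x, h (x - y) := setIntegral_le_integral (hi.comp_sub_right y)
        (Eventually.of_forall fun x => h0 _)
    _ = ∫ x, h x := integral_sub_right_eq_self h y
    _ = _ := integral_indicator hm

/-- A crude bound for poles near the ball, where there is no decay. The last hypothesis lets the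
powers of 1 / ‖y‖ in the Cauchy estimate be dropped, unless there is no correction at all. -/
theorem setIntegral_abs_correctedKernel_le (hn : 1 ≤ n) (N : ℕ → ℕ) {L R M : ℝ} (hL : 0 ≤ L)
    (hM : 0 ≤ M) {y : EuclideanSpace ℝ (Fin n)} (hy : y ≠ 0) (hR : L + ‖y‖ < R)
    (hb : ∀ z : ℂ, 7 / 16 * ‖y‖ ^ 2 ≤ z.re → ‖z‖ ≤ 25 / 16 * ‖y‖ ^ 2 →
      ‖complexRadialKernel n z‖ ≤ M) (h1 : N ⌊‖y‖⌋₊ = 0 ∨ 1 ≤ ‖y‖) :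
    ∫ x in Metric.closedBall 0 L, |correctedKernel N x y| ≤
      (∫ z in Metric.ball (0 : EuclideanSpace ℝ (Fin n)) R, |radialKernel n (‖z‖ ^ 2)|) +
        volume.real (Metric.closedBall (0 : EuclideanSpace ℝ (Fin n)) L) *
          ∑ j ∈ Finset.range (N ⌊‖y‖⌋₊), M * (4 * (L + 1)) ^ j := by
  have hi := integrableOn_radialKernel_sub hn y L
  set S := ∑ j ∈ Finset.range (N ⌊‖y‖⌋₊), M * (4 * (L + 1)) ^ j with hS
  have hc : IntegrableOn (fun _ : EuclideanSpace ℝ (Fin n) => S) (Metric.closedBall 0 L) :=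
    integrableOn_const (isCompact_closedBall _ _).measure_lt_top.ne
  calc ∫ x in Metric.closedBall 0 L, |correctedKernel N x y|
      ≤ ∫ x in Metric.closedBall 0 L, (|radialKernel n (‖x - y‖ ^ 2)| + S) := by
        refine setIntegral_mono_on (integrableOn_correctedKernel hn N hy L).abs
          (hi.abs.add hc) Metric.isClosed_closedBall.measurableSet fun x hx => ?_
        have hx' := mem_closedBall_zero_iff.1 hx
        refine (abs_sub _ _).trans (add_le_add_right ((Finset.abs_sum_le_sum_abs _ _).trans ?_) _)
        refine Finset.sum_le_sum fun j hj => (abs_kernelCoeff_le j hy hb).trans ?_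
        have hy1 : 1 ≤ ‖y‖ := h1.resolve_left fun h => by simp [h] at hj
        gcongr
        rw [div_le_iff₀ (by linarith)]
        nlinarith [norm_nonneg x]
    _ = (∫ x in Metric.closedBall 0 L, |radialKernel n (‖x - y‖ ^ 2)|) +
          volume.real (Metric.closedBall (0 : EuclideanSpace ℝ (Fin n)) L) * S := by
        rw [integral_add hi.abs hc, setIntegral_const, smul_eq_mul]
    _ ≤ _ := by
        gcongr
        exact setIntegral_abs_radialKernel_sub_le hn hR

/-! ### Choice of the degrees and integrability -/

/-- The degrees of the Taylor corrections can be chosen so that the corrected kernel decays as fast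
as desired in the pole. -/
theorem exists_degrees (n : ℕ) {F : ℕ → ℝ} (hF : ∀ k, 0 < F k) :
    ∃ N : ℕ → ℕ, N 0 = 0 ∧ ∀ x y : EuclideanSpace ℝ (Fin n), 8 * (‖x‖ + 1) ≤ ‖y‖ →
      |correctedKernel N x y| ≤ (1 / 2) ^ ⌊‖y‖⌋₊ / F ⌊‖y‖⌋₊ := by
  have key : ∀ k : ℕ, ∃ m : ℕ, (k = 0 → m = 0) ∧ (1 ≤ k → ∃ M, 0 ≤ M ∧
      (∀ y : EuclideanSpace ℝ (Fin n), (k : ℝ) ≤ ‖y‖ → ‖y‖ ≤ k + 1 →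
        ∀ z : ℂ, 7 / 16 * ‖y‖ ^ 2 ≤ z.re → ‖z‖ ≤ 25 / 16 * ‖y‖ ^ 2 →
          ‖complexRadialKernel n z‖ ≤ M) ∧ 2 * M * (1 / 2) ^ m ≤ (1 / 2) ^ k / F k) := by
    intro k
    rcases Nat.eq_zero_or_pos k with rfl | hk
    -- The shell k = 0 contains y = 0, where the expansion degenerates, so it gets no correction.
    · exact ⟨0, fun _ => rfl, fun h => absurd h (by norm_num)⟩
    obtain ⟨M, hM, hb⟩ := exists_bound_near_norm_sq n (a := (k : ℝ)) (by exact_mod_cast hk) (k + 1)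
    -- The summand 1 covers the case M = 0.
    have hpos : 0 < (1 / 2) ^ k / F k / (2 * M + 1) := by
      have := hF k
      positivity
    obtain ⟨m, hm⟩ := exists_pow_lt_of_lt_one hpos (by norm_num : (1 / 2 : ℝ) < 1)
    refine ⟨m, fun h => absurd h hk.ne', fun _ => ⟨M, hM, hb, ?_⟩⟩
    rw [lt_div_iff₀ (by positivity)] at hm
    have : (0 : ℝ) < (1 / 2) ^ m := by positivity
    linarith
  choose N hN0 hN using key
  refine ⟨N, hN0 0 rfl, fun x y hxy => ?_⟩
  have hy8 : 8 ≤ ‖y‖ := by linarith [norm_nonneg x]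
  have hy : y ≠ 0 := by
    rintro rfl
    norm_num at hy8
  obtain ⟨M, hM, hb, hd⟩ := hN ⌊‖y‖⌋₊ (Nat.le_floor (by norm_num; linarith))
  exact (abs_correctedKernel_le N hM hy
    (hb y (Nat.floor_le (norm_nonneg y)) (Nat.lt_floor_add_one _).le) hxy).trans hd

/-- Far shells inherit the prescribed decay. On the finitely many others any finite `D` will do,
since they do not affect summability. -/
theorem exists_bound_setIntegral_correctedKernel (hn : 1 ≤ n) {F : ℕ → ℝ} (hF : ∀ k, 0 < F k)
    {N : ℕ → ℕ} (hN0 : N 0 = 0)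
    (hN : ∀ x y : EuclideanSpace ℝ (Fin n), 8 * (‖x‖ + 1) ≤ ‖y‖ →
      |correctedKernel N x y| ≤ (1 / 2) ^ ⌊‖y‖⌋₊ / F ⌊‖y‖⌋₊) {L : ℝ} (hL : 0 ≤ L) (k : ℕ) :
    ∃ D, 0 ≤ D ∧
      (∀ y : EuclideanSpace ℝ (Fin n), y ≠ 0 → ⌊‖y‖⌋₊ = k →
        ∫ x in Metric.closedBall 0 L, |correctedKernel N x y| ≤ D) ∧
      (8 * (L + 1) ≤ k → D * F k ≤
        volume.real (Metric.closedBall (0 : EuclideanSpace ℝ (Fin n)) L) * (1 / 2) ^ k) := by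
  by_cases hk : 8 * (L + 1) ≤ k
  · have hFk := hF k
    refine ⟨volume.real (Metric.closedBall (0 : EuclideanSpace ℝ (Fin n)) L) *
      ((1 / 2) ^ k / F k), by positivity, fun y hy hyk => ?_, fun _ => ?_⟩
    · have hky : (k : ℝ) ≤ ‖y‖ := hyk ▸ Nat.floor_le (norm_nonneg y)
      have h := norm_setIntegral_le_of_norm_le_const (μ := volume)
        (s := Metric.closedBall (0 : EuclideanSpace ℝ (Fin n)) L)
        (f := fun x => |correctedKernel N x y|) (C := (1 / 2) ^ k / F k)
        (isCompact_closedBall _ _).measure_lt_top fun x hx => by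
          rw [Real.norm_eq_abs, abs_abs, ← hyk]
          have := mem_closedBall_zero_iff.1 hx
          exact hN x y (by linarith)
      rw [mul_comm]
      exact (le_abs_self _).trans h
    · rw [mul_assoc, div_mul_cancel₀ _ hFk.ne']
  · set I := ∫ z in Metric.ball (0 : EuclideanSpace ℝ (Fin n)) (L + k + 2),
      |radialKernel n (‖z‖ ^ 2)| with hI
    have hI0 : 0 ≤ I := integral_nonneg fun _ => abs_nonneg _
    rcases Nat.eq_zero_or_pos k with rfl | hk1
    · refine ⟨I, hI0, fun y hy hyk => ?_, fun h => absurd h hk⟩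
      obtain ⟨M, hM, hb⟩ := exists_bound_near_norm_sq n (norm_pos_iff.2 hy) ‖y‖
      have hR : L + ‖y‖ < L + (0 : ℕ) + 2 := by
        have := Nat.lt_floor_add_one ‖y‖
        rw [hyk] at this
        linarith
      have h := setIntegral_abs_correctedKernel_le hn N hL hM hy hR (hb y le_rfl le_rfl)
        (Or.inl (by rw [hyk, hN0]))
      simpa [hyk, hN0, hI] using h
    · obtain ⟨M, hM, hb⟩ := exists_bound_near_norm_sq n (a := (k : ℝ)) (by exact_mod_cast hk1)
        (k + 1)
      refine ⟨I + volume.real (Metric.closedBall (0 : EuclideanSpace ℝ (Fin n)) L) *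
          ∑ j ∈ Finset.range (N k), M * (4 * (L + 1)) ^ j, by positivity,
        fun y hy hyk => ?_, fun h => absurd h hk⟩
      have hlt := Nat.lt_floor_add_one ‖y‖
      have hle := Nat.floor_le (norm_nonneg y)
      rw [hyk] at hlt hle
      have h := setIntegral_abs_correctedKernel_le hn N hL hM hy (R := L + k + 2) (by linarith)
        (hb y hle hlt.le) (Or.inr (le_trans (by exact_mod_cast hk1) hle))
      rwa [hyk] at h

theorem iUnion_floor_norm_eq :
    ⋃ k : ℕ, {y : EuclideanSpace ℝ (Fin n) | ⌊‖y‖⌋₊ = k} = univ :=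
  eq_univ_of_forall fun y => mem_iUnion.2 ⟨⌊‖y‖⌋₊, rfl⟩

theorem measurableSet_floor_norm_eq (k : ℕ) :
    MeasurableSet {y : EuclideanSpace ℝ (Fin n) | ⌊‖y‖⌋₊ = k} :=
  (Nat.measurable_floor.comp measurable_norm) (measurableSet_singleton k)

theorem integrableOn_floor_norm_eq {f : EuclideanSpace ℝ (Fin n) → ℝ}
    (hf : LocallyIntegrable f volume) (k : ℕ) :
    IntegrableOn f {y | ⌊‖y‖⌋₊ = k} :=
  (hf.integrableOn_isCompact (isCompact_closedBall 0 (k + 1))).mono_set fun y hy => by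
    rw [mem_closedBall_zero_iff]
    have h := Nat.lt_floor_add_one ‖y‖
    rw [show ⌊‖y‖⌋₊ = k from hy] at h
    exact h.le

/-- Integrate in x first, then sum over the shells in y. The denominator prescribed in `hN` cancels
the mass of |f| on a shell, so shell k contributes at most a constant times 2⁻ᵏ when k ≥ 8(L + 1).
-/
theorem integrable_correctedKernel_mul (hn : 1 ≤ n) {f : EuclideanSpace ℝ (Fin n) → ℝ}
    (hf : LocallyIntegrable f volume) {N : ℕ → ℕ} (hN0 : N 0 = 0)
    (hN : ∀ x y : EuclideanSpace ℝ (Fin n), 8 * (‖x‖ + 1) ≤ ‖y‖ →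
      |correctedKernel N x y| ≤
        (1 / 2) ^ ⌊‖y‖⌋₊ / ((∫ z in {z | ⌊‖z‖⌋₊ = ⌊‖y‖⌋₊}, ‖f z‖) + 1))
    {L : ℝ} (hL : 0 ≤ L) :
    Integrable (fun p : EuclideanSpace ℝ (Fin n) × EuclideanSpace ℝ (Fin n) =>
      correctedKernel N p.1 p.2 * f p.2)
      ((volume.restrict (Metric.closedBall 0 L)).prod volume) := by
  have : Nonempty (Fin n) := ⟨⟨0, hn⟩⟩
  have hF0 : ∀ k : ℕ, 0 ≤ ∫ z in {z : EuclideanSpace ℝ (Fin n) | ⌊‖z‖⌋₊ = k}, ‖f z‖ :=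
    fun k => integral_nonneg fun _ => norm_nonneg _
  have hm : AEStronglyMeasurable (fun p : EuclideanSpace ℝ (Fin n) × EuclideanSpace ℝ (Fin n) =>
      correctedKernel N p.1 p.2 * f p.2)
      ((volume.restrict (Metric.closedBall 0 L)).prod volume) :=
    (measurable_correctedKernel N).aestronglyMeasurable.mul hf.aestronglyMeasurable.comp_snd
  have hne : ∀ᵐ y : EuclideanSpace ℝ (Fin n), y ≠ 0 := Measure.ae_ne volume 0
  rw [integrable_prod_iff' hm]
  constructor
  · filter_upwards [hne] with y hy
    exact (integrableOn_correctedKernel hn N hy L).mul_const _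
  choose D hD0 hD hDF using exists_bound_setIntegral_correctedKernel hn
    (F := fun k => (∫ z in {z : EuclideanSpace ℝ (Fin n) | ⌊‖z‖⌋₊ = k}, ‖f z‖) + 1)
    (fun k => by linarith [hF0 k]) hN0 hN hL
  have hH : ∀ y, ∫ x in Metric.closedBall 0 L, ‖correctedKernel N x y * f y‖ =
      (∫ x in Metric.closedBall 0 L, |correctedKernel N x y|) * ‖f y‖ := by
    intro y
    simp_rw [norm_mul, integral_mul_const, Real.norm_eq_abs]
  have hHm : AEStronglyMeasurable
      (fun y => ∫ x in Metric.closedBall 0 L, ‖correctedKernel N x y * f y‖) volume :=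
    hm.norm.prod_swap.integral_prod_right'
  have hb : ∀ k, ∀ᵐ y ∂(volume.restrict {y : EuclideanSpace ℝ (Fin n) | ⌊‖y‖⌋₊ = k}),
      ‖∫ x in Metric.closedBall 0 L, ‖correctedKernel N x y * f y‖‖ ≤ D k * ‖f y‖ := by
    intro k
    filter_upwards [ae_restrict_mem (measurableSet_floor_norm_eq k), ae_restrict_of_ae hne]
      with y hy hy0
    rw [Real.norm_of_nonneg (integral_nonneg fun _ => norm_nonneg _), hH]
    exact mul_le_mul_of_nonneg_right (hD k y hy0 hy) (norm_nonneg _)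
  have hi : ∀ k, IntegrableOn
      (fun y => ∫ x in Metric.closedBall 0 L, ‖correctedKernel N x y * f y‖)
      {y : EuclideanSpace ℝ (Fin n) | ⌊‖y‖⌋₊ = k} := fun k =>
    (((integrableOn_floor_norm_eq hf k).norm).const_mul (D k)).mono' hHm.restrict (hb k)
  rw [← integrableOn_univ, ← iUnion_floor_norm_eq]
  refine integrableOn_iUnion_of_summable_integral_norm hi ?_
  have hsum : Summable fun k : ℕ =>
      volume.real (Metric.closedBall (0 : EuclideanSpace ℝ (Fin n)) L) * (1 / 2 : ℝ) ^ k :=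
    summable_geometric_two.mul_left _
  obtain ⟨k₀, hk₀⟩ := exists_nat_ge (8 * (L + 1))
  refine hsum.of_norm_bounded_eventually_nat ?_
  filter_upwards [eventually_ge_atTop k₀] with k hk
  rw [Real.norm_of_nonneg (integral_nonneg fun _ => norm_nonneg _)]
  calc ∫ y in {y : EuclideanSpace ℝ (Fin n) | ⌊‖y‖⌋₊ = k},
        ‖∫ x in Metric.closedBall 0 L, ‖correctedKernel N x y * f y‖‖
      ≤ ∫ y in {y : EuclideanSpace ℝ (Fin n) | ⌊‖y‖⌋₊ = k}, D k * ‖f y‖ :=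
        integral_mono_ae (hi k).norm (((integrableOn_floor_norm_eq hf k).norm).const_mul (D k))
          (hb k)
    _ = D k * ∫ y in {y : EuclideanSpace ℝ (Fin n) | ⌊‖y‖⌋₊ = k}, ‖f y‖ := integral_const_mul _ _
    _ ≤ D k * ((∫ y in {y : EuclideanSpace ℝ (Fin n) | ⌊‖y‖⌋₊ = k}, ‖f y‖) + 1) :=
        mul_le_mul_of_nonneg_left (by linarith) (hD0 k)
    _ ≤ _ := hDF k (hk₀.trans (by exact_mod_cast hk))

/-! ### The solution -/

theorem exists_isWeakSolutionPoisson (hn : 1 ≤ n) {f : EuclideanSpace ℝ (Fin n) → ℝ}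
    (hf : LocallyIntegrable f volume) : ∃ u, IsWeakSolutionPoisson u f := by
  have : Nonempty (Fin n) := ⟨⟨0, hn⟩⟩
  obtain ⟨N, hN0, hN⟩ := exists_degrees n
    (F := fun k => (∫ z in {z : EuclideanSpace ℝ (Fin n) | ⌊‖z‖⌋₊ = k}, ‖f z‖) + 1)
    (fun k => by
      have : 0 ≤ ∫ z in {z : EuclideanSpace ℝ (Fin n) | ⌊‖z‖⌋₊ = k}, ‖f z‖ :=
        integral_nonneg fun _ => norm_nonneg _
      linarith)
  have hint := fun {L : ℝ} (hL : 0 ≤ L) => integrable_correctedKernel_mul hn hf hN0 hN hL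
  have hmass := radialKernelMass_pos hn
  have hu : LocallyIntegrable (fun x => ∫ y, correctedKernel N x y * f y) volume := by
    rw [locallyIntegrable_iff]
    intro K hK
    obtain ⟨L, hL⟩ := hK.isBounded.subset_closedBall 0
    have h : IntegrableOn (fun x => ∫ y, correctedKernel N x y * f y)
      (Metric.closedBall 0 (max L 0)) := (hint (le_max_right L 0)).integral_prod_left
    exact h.mono_set (hL.trans (Metric.closedBall_subset_closedBall (le_max_left _ _)))
  refine ⟨fun x => (radialKernelMass n)⁻¹ * ∫ y, correctedKernel N x y * f y,
    hu.smul (radialKernelMass n)⁻¹, hf, fun φ hφ hc => ?_⟩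
  obtain ⟨L, hL, -, hs⟩ := exists_radius_of_hasCompactSupport hc
  have hψ := continuous_laplacian (hφ.of_le (by norm_cast) : ContDiff ℝ 2 φ)
  obtain ⟨C, hC⟩ := hψ.bounded_above_of_compact_support (hasCompactSupport_laplacian hc)
  -- Δφ vanishes outside the ball, so x can be confined to it, where joint integrability is known.
  have hres : ∀ g : EuclideanSpace ℝ (Fin n) → ℝ,
      ∫ x in Metric.closedBall 0 L, g x * (Δ φ) x = ∫ x, g x * (Δ φ) x := fun g =>
    setIntegral_eq_integral_of_forall_compl_eq_zero fun x hx => by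
      rw [hs x (not_le.1 fun h => hx (mem_closedBall_zero_iff.2 h)), mul_zero]
  have hprod : Integrable (Function.uncurry fun x y : EuclideanSpace ℝ (Fin n) =>
      correctedKernel N x y * f y * (Δ φ) x)
      ((volume.restrict (Metric.closedBall 0 L)).prod volume) :=
    (hint hL).mul_bdd (c := C) (hψ.comp continuous_fst).aestronglyMeasurable
      (Eventually.of_forall fun p => hC p.1)
  calc ∫ x, (radialKernelMass n)⁻¹ * (∫ y, correctedKernel N x y * f y) * (Δ φ) x
      = (radialKernelMass n)⁻¹ *
          ∫ x in Metric.closedBall 0 L, ∫ y, correctedKernel N x y * f y * (Δ φ) x := by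
        simp_rw [integral_mul_const, mul_assoc]
        rw [integral_const_mul, hres]
    _ = (radialKernelMass n)⁻¹ *
          ∫ y, ∫ x in Metric.closedBall 0 L, correctedKernel N x y * f y * (Δ φ) x := by
        rw [integral_integral_swap hprod]
    _ = (radialKernelMass n)⁻¹ * ∫ y, radialKernelMass n * (f y * φ y) := by
        congr 1
        refine integral_congr_ae ?_
        -- The pole y = 0, excluded from the Taylor estimates, is a null set.
        filter_upwards [Measure.ae_ne volume (0 : EuclideanSpace ℝ (Fin n))] with y hy
        have h := integral_correctedKernel_mul_laplacian hn N hy hφ hc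
        rw [← hres] at h
        calc ∫ x in Metric.closedBall 0 L, correctedKernel N x y * f y * (Δ φ) x
            = ∫ x in Metric.closedBall 0 L, f y * (correctedKernel N x y * (Δ φ) x) := by
              congr 1
              ext x
              ring
          _ = radialKernelMass n * (f y * φ y) := by
              rw [integral_const_mul, h]
              ring
    _ = ∫ y, f y * φ y := by
        rw [integral_const_mul, inv_mul_cancel_left₀ hmass.ne']

theorem MemLpLoc.locallyIntegrable {p : ℝ≥0∞} (hp : 1 ≤ p) {f : EuclideanSpace ℝ (Fin n) → ℝ}
    (hf : MemLpLoc f p) : LocallyIntegrable f volume := by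
  rw [locallyIntegrable_iff]
  intro K hK
  have : IsFiniteMeasure (volume.restrict K) := ⟨by simpa using hK.measure_lt_top⟩
  exact (hf K hK).integrable hp

end

theorem theorem2p1 (n : ℕ) (hn : 1 ≤ n) (p : ℝ≥0∞) (hp : 1 ≤ p)
    (f : EuclideanSpace ℝ (Fin n) → ℝ) (hf : MemLpLoc f p) :
    ∃ u : EuclideanSpace ℝ (Fin n) → ℝ, IsWeakSolutionPoisson u f :=
  exists_isWeakSolutionPoisson hn (hf.locallyIntegrable hp)
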